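/- A \emph{Markov decision process} (MDP) $\mathcal M$ consists of a countable set $S$ of states, partitioned into controlled states and random states, a transition relation $\longrightarrow\subseteq S\times S$ such that every state has at least one successor (and possibly infinitely many), for each random state $s$ a probability distribution $P(s)$ over the successors of $s$, and a reward function $r:S\times S\to\mathbb R$. A strategy assigns to each finite partial run ending in a controlled state a probability distribution over the successors of that state; together with an initial state $s$ it induces a probability measure $\mathcal P_{\mathcal M,s,\sigma}$ on the infinite runs from $s$. A strategy is \emph{deterministic} if all its choices are Dirac distributions, \emph{memoryless} if its choices depend only on the current state, and \emph{Markov} (a step-counter strategy) if its choices depend only on the current state and the number of steps taken so far; MD means memoryless deterministic. Let $$\mathit{PP}_{\liminf\ge 0}=\Bigl\{\rho=s_0s_1s_2\cdots \;\Big|\; \liminf_{n\to\infty} r(s_n,s_{n+1})\ge 0\Bigr\},$$ where the $\liminf$ is taken in $[-\infty,\infty]$. A strategy $\sigma$ is \emph{$\varepsilon$-optimal from $s$} for an objective $\varphi$ if $\mathcal P_{\mathcal M,s,\sigma}(\varphi)\ge \sup_{\sigma'}\mathcal P_{\mathcal M,s,\sigma'}(\varphi)-\varepsilon$, the supremum being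 over all strategies. The step-counter-encoded MDP $S(\mathcal M)$ has state space $S\times\mathbb N$, where $(s,n)$ is controlled if and only if $s$ is; its transitions are $(s,n)\longrightarrow(s',n+1)$ for $s\longrightarrow s'$ in $\mathcal M$, with the same probabilities and rewards as $s\longrightarrow s'$. \textbf{Theorem.} Let $\mathcal M$ be an MDP with countable state space, possibly infinitely branching, and with initial state $s_0$. For every $\varepsilon>0$: \begin{itemize} \item there exists an MD strategy in $S(\mathcal M)$ that is $\varepsilon$-optimal for $\mathit{PP}_{\liminf\ge 0}$ from the initial state $(s_0,0)$ of $S(\mathcal M)$; \item there exists a deterministic Markov strategy in $\mathcal M$ that is $\varepsilon$-optimal for $\mathit{PP}_{\liminf\ge 0}$ from $s_0$. \end{itemize} -/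

import Mathlib

open MeasureTheory ProbabilityTheory Filter
open scoped ENNReal

/-- A Markov decision process with state space `S` (countability of `S` is a separate hypothesis).
States outside `controlled` are the random ones; `prob` gives each random state a distribution over
its successors. No bound on the number of successors of a state is imposed. -/
structure MDP (S : Type*) where
  controlled : Set S
  step : S → S → Prop
  exists_step : ∀ s, ∃ t, step s t
  prob : ↥(controlledᶜ) → PMF S
  step_of_mem_support : ∀ s, ∀ t ∈ (prob s).support, step s t
  reward : S → S → ℝ

namespace MDP

/-- A history with `n` transitions: the finite state sequence `s₀ s₁ … sₙ`. (Transitions are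
determined by the states they join, so they are left implicit.) -/
abbrev History (S : Type*) (n : ℕ) : Type _ := (i : Finset.Iic n) → (fun _ : ℕ => S) i

/-- The last (current) state `sₙ` of a history `s₀ s₁ … sₙ`. -/
def History.last {S : Type*} {n : ℕ} (h : History S n) : S :=
  h ⟨n, Finset.mem_Iic.2 le_rfl⟩

/-- A (history-dependent, randomized) strategy: to each history ending in a controlled state it
assigns a distribution over the successors of that state. It is given as a total function; its
values at histories ending in a random state are never used, and its values at sequences that are
not partial runs do not influence the probability measure on runs. -/
structure Strategy {S : Type*} (M : MDP S) where
  choose : (n : ℕ) → History S n → PMF S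
  step_of_mem_support : ∀ (n : ℕ) (h : History S n), h.last ∈ M.controlled →
    ∀ t ∈ (choose n h).support, M.step h.last t

/-- All choices are Dirac distributions. -/
def Strategy.IsDeterministic {S : Type*} {M : MDP S} (σ : M.Strategy) : Prop :=
  ∀ (n : ℕ) (h : History S n), h.last ∈ M.controlled → ∃ t : S, σ.choose n h = PMF.pure t

/-- Choices depend on the current state only. -/
def Strategy.IsMemoryless {S : Type*} {M : MDP S} (σ : M.Strategy) : Prop :=
  ∃ f : S → PMF S, ∀ (n : ℕ) (h : History S n), h.last ∈ M.controlled →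
    σ.choose n h = f h.last

/-- Choices depend on the current state and on the number of steps taken so far only
(Markov, or step-counter, strategies). -/
def Strategy.IsMarkov {S : Type*} {M : MDP S} (σ : M.Strategy) : Prop :=
  ∃ f : ℕ → S → PMF S, ∀ (n : ℕ) (h : History S n), h.last ∈ M.controlled →
    σ.choose n h = f n h.last

open Classical in
/-- The distribution of the next state after the history `h` under the strategy `σ`: chosen by `σ`
in controlled states, by the MDP in random states. -/
noncomputable def Strategy.next {S : Type*} {M : MDP S} (σ : M.Strategy) (n : ℕ)
    (h : History S n) : PMF S :=
  if hs : h.last ∈ M.controlled then σ.choose n h else M.prob ⟨h.last, hs⟩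

/-- The next-state distribution as a Markov kernel from histories to states. -/
noncomputable def Strategy.nextKernel {S : Type*} [Countable S] [MeasurableSpace S]
    [DiscreteMeasurableSpace S] {M : MDP S} (σ : M.Strategy) (n : ℕ) :
    Kernel (History S n) S :=
  Kernel.ofFunOfCountable fun h => (σ.next n h).toMeasure

instance {S : Type*} [Countable S] [MeasurableSpace S] [DiscreteMeasurableSpace S] {M : MDP S}
    (σ : M.Strategy) (n : ℕ) : IsMarkovKernel (σ.nextKernel n) :=
  ⟨fun h => PMF.toMeasure.isProbabilityMeasure (σ.next n h)⟩

/-- The probability measure on infinite state sequences induced by the initial state `s₀` and the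
strategy `σ`: the Ionescu-Tulcea measure, under which the cylinder of `s₀ s₁ … sₙ` has measure
`∏ i < n, σ.next i (s₀ … sᵢ) sᵢ₊₁` and every cylinder with another first state is null. -/
noncomputable def runMeasure {S : Type*} [Countable S] [MeasurableSpace S]
    [DiscreteMeasurableSpace S] (M : MDP S) (s₀ : S) (σ : M.Strategy) : Measure (ℕ → S) :=
  Kernel.traj (X := fun _ => S) σ.nextKernel 0 (fun _ => s₀)

/-- The infinite runs of `M` from `s₀`. -/
def runs {S : Type*} (M : MDP S) (s₀ : S) : Set (ℕ → S) :=
  {ρ | ρ 0 = s₀ ∧ ∀ n, M.step (ρ n) (ρ (n + 1))}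

/-- The point payoff objective from `s₀`: the runs from `s₀` along which the limit inferior (in the
extended reals) of the transition rewards is nonnegative. -/
def pointPayoff {S : Type*} (M : MDP S) (s₀ : S) : Set (ℕ → S) :=
  {ρ | ρ ∈ M.runs s₀ ∧ 0 ≤ liminf (fun n => (M.reward (ρ n) (ρ (n + 1)) : EReal)) atTop}

/-- The value of `s₀` for the objective `φ`: the supremum over all strategies of the probability
of `φ`. -/
noncomputable def value {S : Type*} [Countable S] [MeasurableSpace S]
    [DiscreteMeasurableSpace S] (M : MDP S) (φ : Set (ℕ → S)) (s₀ : S) : ℝ≥0∞ :=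
  ⨆ σ : M.Strategy, M.runMeasure s₀ σ φ

/-- `σ` attains the objective `φ` from `s₀` with probability at least the value minus `ε`. -/
def Strategy.IsEpsOptimal {S : Type*} [Countable S] [MeasurableSpace S]
    [DiscreteMeasurableSpace S] {M : MDP S} (σ : M.Strategy) (φ : Set (ℕ → S)) (s₀ : S)
    (ε : ℝ) : Prop :=
  M.value φ s₀ ≤ M.runMeasure s₀ σ φ + ENNReal.ofReal ε

/-- The MDP `S(M)` that encodes the step counter into the states: the transitions are
`(s, n) ⟶ (t, n + 1)` for `s ⟶ t` in `M`, with the probabilities and rewards of `M`. -/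
noncomputable def stepEncode {S : Type*} (M : MDP S) : MDP (S × ℕ) where
  controlled := {p | p.1 ∈ M.controlled}
  step p q := M.step p.1 q.1 ∧ q.2 = p.2 + 1
  exists_step p := by
    obtain ⟨t, ht⟩ := M.exists_step p.1
    exact ⟨(t, p.2 + 1), ht, rfl⟩
  prob p := (M.prob ⟨p.1.1, p.2⟩).map fun t => (t, p.1.2 + 1)
  step_of_mem_support p q hq := by
    rw [PMF.mem_support_map_iff] at hq
    obtain ⟨t, ht, rfl⟩ := hq
    exact ⟨M.step_of_mem_support _ t ht, rfl⟩
  reward p q := M.reward p.1 q.1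

end MDP

/-!
For every run with nonnegative limit inferior of the rewards and every `k`, there is a time from
which all rewards are at least `-1 / (k + 1)`. Fix a strategy `σ` that is nearly optimal for the
point payoff objective. By continuity from above there are deterministic times `N k` such that,
outside a set of small `σ`-probability, every winning run has rewards at least `-1 / (k + 1)` from
time `N k` on (`MDP.exists_runMeasure_pointPayoff_le`). So `σ` achieves almost the value for a
*safety* objective inside the point payoff objective: at each time `n`, the transition taken has to
belong to a relation `T n`. This is where the step counter is needed.

For such a safety objective the step counter also suffices. Let `u n s` be the supremum, over all
histories of length `n` that end in `s`, of the conditional probability under `σ` of being safe from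
time `n` on. These weights satisfy the Bellman inequality
(`MDP.Strategy.isSubharmonic_safety`), so in a controlled state `s` at time `n` some successor loses
at most `δ n` of the weight (`MDP.IsSubharmonic.exists_greedy`). Because every time occurs exactly
once, always choosing such a successor loses at most `∑ n, δ n` altogether
(`MDP.IsSubharmonic.le_traj_safeOn`), which is small, and `u 0 s₀` is the safety probability of `σ`
from `s₀`. The resulting choices depend only on the time and the current state, and in
`M.stepEncode` the time can be read off the state.
-/

namespace MDP

variable {S : Type*}

/-! ### Histories and deterministic strategies -/

/-- The history `s₀ … sₙ t` obtained from `s₀ … sₙ` by appending the state `t`. -/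
def History.extend {n : ℕ} (h : History S n) (t : S) : History S (n + 1) :=
  IicProdIoc (X := fun _ : ℕ => S) n (n + 1) (h, fun _ => t)

@[simp]
lemma History.last_extend {n : ℕ} (h : History S n) (t : S) : (h.extend t).last = t := by
  simp [History.extend, History.last, IicProdIoc]

lemma History.extend_apply_self {n : ℕ} (h : History S n) (t : S) :
    h.extend t ⟨n, Finset.mem_Iic.2 n.le_succ⟩ = h.last := by
  simp [History.extend, History.last, IicProdIoc]

/-- The strategy that makes the Dirac choice `f n h` after each history `h` of length `n`. -/
noncomputable def Strategy.ofFun {M : MDP S} (f : (n : ℕ) → History S n → S)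
    (hf : ∀ n h, M.step h.last (f n h)) : M.Strategy where
  choose n h := PMF.pure (f n h)
  step_of_mem_support n h _ t ht := by
    rw [PMF.mem_support_pure_iff] at ht
    exact ht ▸ hf n h

lemma Strategy.ofFun_isDeterministic {M : MDP S} (f : (n : ℕ) → History S n → S)
    (hf : ∀ n h, M.step h.last (f n h)) : (Strategy.ofFun f hf).IsDeterministic :=
  fun n h _ => ⟨f n h, rfl⟩

instance (M : MDP S) : Nonempty M.Strategy :=
  ⟨Strategy.ofFun (fun _ h => (M.exists_step h.last).choose)
    fun _ h => (M.exists_step h.last).choose_spec⟩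

/-! ### Time-dependent safety objectives -/

/-- The runs whose `n`-th transition belongs to the relation `T n`, for every `n ≥ a`. -/
def safeFrom (T : ℕ → S → S → Prop) (a : ℕ) : Set (ℕ → S) :=
  {ρ | ∀ n, a ≤ n → T n (ρ n) (ρ (n + 1))}

/-- The runs whose `n`-th transition belongs to the relation `T n`, whenever `a ≤ n < b`. -/
def safeOn (T : ℕ → S → S → Prop) (a b : ℕ) : Set (ℕ → S) :=
  {ρ | ∀ n, a ≤ n → n < b → T n (ρ n) (ρ (n + 1))}

lemma safeFrom_eq_inter (T : ℕ → S → S → Prop) (a : ℕ) :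
    safeFrom T a = {ρ | T a (ρ a) (ρ (a + 1))} ∩ safeFrom T (a + 1) := by
  ext ρ
  refine ⟨fun h => ⟨h a le_rfl, fun n hn => h n (by omega)⟩, fun h n hn => ?_⟩
  obtain rfl | hn := hn.eq_or_lt
  exacts [h.1, h.2 n hn]

lemma safeOn_eq_inter (T : ℕ → S → S → Prop) {a b : ℕ} (hab : a < b) :
    safeOn T a b = {ρ | T a (ρ a) (ρ (a + 1))} ∩ safeOn T (a + 1) b := by
  ext ρ
  refine ⟨fun h => ⟨h a le_rfl hab, fun n hn => h n (by omega)⟩, fun h n hn hb => ?_⟩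
  obtain rfl | hn := hn.eq_or_lt
  exacts [h.1, h.2 n hn hb]

/-! ### The Bellman inequality and greedy choices -/

open Classical in
/-- The weights `u n s` (for the state `s` at time `n`) satisfy the Bellman inequality of the safety
objective "the transition at each time `n` belongs to `T n`". In a controlled state without a
successor in `T n` the supremum is empty, which forces `u n s = 0`. -/
structure IsSubharmonic (M : MDP S) (T : ℕ → S → S → Prop) (u : ℕ → S → ℝ≥0∞) : Prop where
  controlled : ∀ n, ∀ s ∈ M.controlled, u n s ≤ ⨆ t, ⨆ _ : T n s t, u (n + 1) t
  random : ∀ n (s : ↥(M.controlledᶜ)),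
    u n s ≤ ∑' t, M.prob s t * if T n s t then u (n + 1) t else 0

open Classical in
/-- Nearly greedy choices: no bound on the number of successors is available, so the supremum in the
Bellman inequality is attained at time `n` only up to an error `δ n`. -/
lemma IsSubharmonic.exists_greedy {M : MDP S} {T : ℕ → S → S → Prop} {u : ℕ → S → ℝ≥0∞}
    (hu : IsSubharmonic M T u) (hu_one : ∀ n s, u n s ≤ 1) (hT : ∀ n s t, T n s t → M.step s t)
    {δ : ℕ → ℝ≥0∞} (hδ : ∀ n, δ n ≠ 0) :
    ∃ f : ℕ → S → S, (∀ n s, M.step s (f n s)) ∧ ∀ n, ∀ s ∈ M.controlled,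
      u n s ≤ (if T n s (f n s) then u (n + 1) (f n s) else 0) + δ n := by
  have key : ∀ n s, ∃ t, M.step s t ∧ (s ∈ M.controlled →
      u n s ≤ (if T n s t then u (n + 1) t else 0) + δ n) := by
    intro n s
    by_cases hs : s ∈ M.controlled ∧ u n s ≠ 0
    · have hlt : u n s - δ n < ⨆ t, ⨆ _ : T n s t, u (n + 1) t :=
        (ENNReal.sub_lt_self ((hu_one n s).trans_lt ENNReal.one_lt_top).ne hs.2 (hδ n)).trans_le
          (hu.controlled n s hs.1)
      simp only [lt_iSup_iff] at hlt
      obtain ⟨t, ht, hlt⟩ := hlt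
      exact ⟨t, hT n s t ht, fun _ => by rw [if_pos ht]; exact tsub_le_iff_right.1 hlt.le⟩
    · obtain ⟨t, ht⟩ := M.exists_step s
      refine ⟨t, ht, fun hc => ?_⟩
      have h0 : u n s = 0 := by simpa [hc] using hs
      rw [h0]
      exact zero_le
  choose f hf using key
  exact ⟨f, fun n s => (hf n s).1, fun n s => (hf n s).2⟩

/-! ### Point payoff as a safety objective -/

/-- The transitions of `M` that, for every `k`, have reward at least `-1 / (k + 1)` once the time
has reached `N k`. -/
def allowed (M : MDP S) (N : ℕ → ℕ) (n : ℕ) (s t : S) : Prop :=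
  M.step s t ∧ ∀ k, N k ≤ n → -1 / ((k : ℝ) + 1) ≤ M.reward s t

lemma mem_pointPayoff_of_mem_safeFrom {M : MDP S} {s₀ : S} {N : ℕ → ℕ} {ρ : ℕ → S}
    (h0 : ρ 0 = s₀) (h : ρ ∈ safeFrom (M.allowed N) 0) : ρ ∈ M.pointPayoff s₀ := by
  refine ⟨⟨h0, fun n => (h n zero_le).1⟩, ?_⟩
  have hk : ∀ k : ℕ, ((-1 / ((k : ℝ) + 1) : ℝ) : EReal) ≤
      liminf (fun n => (M.reward (ρ n) (ρ (n + 1)) : EReal)) atTop := fun k =>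
    le_liminf_of_le (h := (eventually_ge_atTop (N k)).mono fun n hn =>
      EReal.coe_le_coe_iff.2 ((h n zero_le).2 k hn))
  refine le_of_tendsto' (f := fun k : ℕ => ((-1 / ((k : ℝ) + 1) : ℝ) : EReal)) (x := atTop) ?_ hk
  rw [← EReal.coe_zero, EReal.tendsto_coe]
  simpa [neg_div] using (tendsto_one_div_add_atTop_nhds_zero_nat (𝕜 := ℝ)).neg

/-- The runs on which the rewards are eventually at least `c`, but not from time `n` on. -/
def late (M : MDP S) (c : ℝ) (n : ℕ) : Set (ℕ → S) :=
  {ρ | (∃ m, ∀ i, m ≤ i → c ≤ M.reward (ρ i) (ρ (i + 1))) ∧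
    ¬ ∀ i, n ≤ i → c ≤ M.reward (ρ i) (ρ (i + 1))}

lemma pointPayoff_subset (M : MDP S) (s₀ : S) (N : ℕ → ℕ) :
    M.pointPayoff s₀ ⊆
      safeFrom (M.allowed N) 0 ∪ ⋃ k : ℕ, M.late (-1 / ((k : ℝ) + 1)) (N k) := by
  rintro ρ ⟨hρ, hlim⟩
  rw [Set.mem_union, or_iff_not_imp_right]
  refine fun hnot n _ => ⟨hρ.2 n, fun k hk => ?_⟩
  by_contra hlt
  refine hnot (Set.mem_iUnion.2 ⟨k, ?_, fun h => hlt (h n hk)⟩)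
  have hneg : ((-1 / ((k : ℝ) + 1) : ℝ) : EReal) < 0 := by
    rw [← EReal.coe_zero, EReal.coe_lt_coe_iff]
    exact div_neg_of_neg_of_pos (by norm_num) (by positivity)
  obtain ⟨m, hm⟩ := eventually_atTop.1 (eventually_lt_of_lt_liminf (hneg.trans_le hlim))
  exact ⟨m, fun i hi => (EReal.coe_lt_coe_iff.1 (hm i hi)).le⟩

variable [Countable S] [MeasurableSpace S] [DiscreteMeasurableSpace S] {M : MDP S}

/-! ### Measurability and the Markov property -/

lemma measurableSet_transition (R : S → S → Prop) (n : ℕ) :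
    MeasurableSet {ρ : ℕ → S | R (ρ n) (ρ (n + 1))} :=
  (show Measurable fun ρ : ℕ → S => (ρ n, ρ (n + 1)) by fun_prop)
    (MeasurableSet.of_discrete (s := {p : S × S | R p.1 p.2}))

lemma measurableSet_safeFrom (T : ℕ → S → S → Prop) (a : ℕ) : MeasurableSet (safeFrom T a) := by
  simp only [safeFrom, Set.ofPred_forall]
  exact .iInter fun n => .iInter fun _ => measurableSet_transition (T n) n

lemma measurableSet_safeOn (T : ℕ → S → S → Prop) (a b : ℕ) : MeasurableSet (safeOn T a b) := by
  simp only [safeOn, Set.ofPred_forall]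
  exact .iInter fun n => .iInter fun _ => .iInter fun _ => measurableSet_transition (T n) n

lemma ae_traj_frestrictLe (σ : M.Strategy) (n : ℕ) (h : History S n) :
    ∀ᵐ ρ ∂Kernel.traj (X := fun _ => S) σ.nextKernel n h, Preorder.frestrictLe n ρ = h := by
  have := Kernel.traj_map_frestrictLe_apply (X := fun _ => S) (κ := σ.nextKernel) n n h
  rw [Kernel.partialTraj_self, Kernel.id_apply] at this
  refine ae_of_ae_map (p := fun x => x = h) (by fun_prop) ?_
  rw [this, ae_dirac_eq]
  rfl

/-- The Markov property: after one more step from the history `h`, the process continues from the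
extended history. -/
lemma traj_apply_eq_tsum (σ : M.Strategy) (n : ℕ) (h : History S n) {B : Set (ℕ → S)}
    (hB : MeasurableSet B) :
    Kernel.traj (X := fun _ => S) σ.nextKernel n h B =
      ∑' t, σ.next n h t *
        Kernel.traj (X := fun _ => S) σ.nextKernel (n + 1) (h.extend t) B := by
  have hm : Measurable fun x => Kernel.traj (X := fun _ => S) σ.nextKernel (n + 1) x B :=
    Kernel.measurable_coe _ hB
  rw [← Kernel.traj_comp_partialTraj (X := fun _ => S) (κ := σ.nextKernel) n.le_succ,
    Kernel.comp_apply' _ _ _ hB, Kernel.partialTraj_succ_self,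
    Kernel.lintegral_map _ (by fun_prop) _ hm,
    Kernel.lintegral_id_prod (f := fun a => Kernel.traj (X := fun _ => S) σ.nextKernel (n + 1)
      (IicProdIoc (X := fun _ => S) n (n + 1) a) B) (hm.comp (by fun_prop)),
    Kernel.lintegral_map (g' := fun b => Kernel.traj (X := fun _ => S) σ.nextKernel (n + 1)
      (IicProdIoc (X := fun _ => S) n (n + 1) (h, b)) B) _ (by fun_prop) _
      (hm.comp (by fun_prop)), lintegral_countable']
  refine tsum_congr fun t => ?_
  rw [mul_comm]
  congr 1
  · exact (σ.next n h).toMeasure_apply_singleton t (measurableSet_singleton t)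
  · congr 2
    ext i
    simp only [History.extend, IicProdIoc, MeasurableEquiv.piSingleton]
    split_ifs <;> simp

open Classical in
/-- The Markov property for events that constrain the next transition and the run after it. -/
lemma traj_transition_inter (σ : M.Strategy) (n : ℕ) (h : History S n) (R : S → S → Prop)
    {A : Set (ℕ → S)} (hA : MeasurableSet A) :
    Kernel.traj (X := fun _ => S) σ.nextKernel n h ({ρ | R (ρ n) (ρ (n + 1))} ∩ A) =
      ∑' t, σ.next n h t * if R h.last t then
        Kernel.traj (X := fun _ => S) σ.nextKernel (n + 1) (h.extend t) A else 0 := by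
  rw [traj_apply_eq_tsum σ n h ((measurableSet_transition R n).inter hA)]
  refine tsum_congr fun t => ?_
  congr 1
  have hae : ∀ᵐ ρ ∂Kernel.traj (X := fun _ => S) σ.nextKernel (n + 1) (h.extend t),
      ρ n = h.last ∧ ρ (n + 1) = t := by
    filter_upwards [ae_traj_frestrictLe σ (n + 1) (h.extend t)] with ρ hρ
    refine ⟨?_, ?_⟩
    · rw [← h.extend_apply_self t, ← hρ]; rfl
    · conv_rhs => rw [← h.last_extend t, ← hρ]
      rfl
  split_ifs with hR
  · refine measure_congr ?_
    filter_upwards [hae] with ρ hρ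
    refine propext ⟨fun hm => hm.2, fun hm => ⟨?_, hm⟩⟩
    change R _ _
    rwa [hρ.1, hρ.2]
  · rw [measure_eq_zero_iff_ae_notMem]
    filter_upwards [hae] with ρ hρ hm
    have h1 : R _ _ := hm.1
    rw [hρ.1, hρ.2] at h1
    exact hR h1

/-! ### Safety probabilities of a strategy -/

/-- The supremum, over all histories of length `n` ending in `s`, of the probability that the
process continued from the history under `σ` is safe from time `n` on. -/
noncomputable def Strategy.safety (σ : M.Strategy) (T : ℕ → S → S → Prop) (n : ℕ) (s : S) :
    ℝ≥0∞ :=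
  ⨆ h : History S n, ⨆ _ : h.last = s,
    Kernel.traj (X := fun _ => S) σ.nextKernel n h (safeFrom T n)

lemma Strategy.le_safety (σ : M.Strategy) (T : ℕ → S → S → Prop) (n : ℕ) (h : History S n) :
    Kernel.traj (X := fun _ => S) σ.nextKernel n h (safeFrom T n) ≤ σ.safety T n h.last :=
  le_iSup₂_of_le h rfl le_rfl

lemma Strategy.safety_le_one (σ : M.Strategy) (T : ℕ → S → S → Prop) (n : ℕ) (s : S) :
    σ.safety T n s ≤ 1 :=
  iSup₂_le fun _ _ => prob_le_one

/-- Whatever the strategy remembers, its safety probabilities obey the Bellman inequality: the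
memory only selects one of the histories over which the supremum is taken. -/
lemma Strategy.isSubharmonic_safety (σ : M.Strategy) (T : ℕ → S → S → Prop) :
    IsSubharmonic M T (σ.safety T) where
  controlled n s hs := by
    classical
    refine iSup₂_le fun h hh => ?_
    rw [safeFrom_eq_inter, traj_transition_inter σ n h (T n) (measurableSet_safeFrom T _)]
    calc _ ≤ ∑' t, σ.next n h t * ⨆ t, ⨆ _ : T n s t, σ.safety T (n + 1) t := by
          refine ENNReal.tsum_le_tsum fun t => mul_le_mul_right ?_ _
          split_ifs with hT
          · refine le_iSup₂_of_le t (hh ▸ hT) ?_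
            simpa using σ.le_safety T (n + 1) (h.extend t)
          · exact zero_le
      _ = _ := by rw [ENNReal.tsum_mul_right, PMF.tsum_coe, one_mul]
  random n s := by
    classical
    refine iSup₂_le fun h hh => ?_
    rw [safeFrom_eq_inter, traj_transition_inter σ n h (T n) (measurableSet_safeFrom T _)]
    have hs : h.last ∉ M.controlled := hh ▸ s.2
    have hnext : σ.next n h = M.prob s := by
      rw [Strategy.next, dif_neg hs]
      congr 1
      exact Subtype.ext hh
    rw [hnext]
    refine ENNReal.tsum_le_tsum fun t => mul_le_mul_right ?_ _
    rw [hh]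
    split_ifs
    · simpa using σ.le_safety T (n + 1) (h.extend t)
    · exact le_rfl

/-! ### The loss of nearly greedy strategies -/

/-- A strategy that plays nearly greedy choices on the histories obeying the invariant `C` loses at
most the accumulated errors against the subharmonic weight `u`. -/
lemma IsSubharmonic.le_traj_safeOn {T : ℕ → S → S → Prop} {u : ℕ → S → ℝ≥0∞}
    (hu : IsSubharmonic M T u) (hu_one : ∀ n s, u n s ≤ 1) {δ : ℕ → ℝ≥0∞} {f : ℕ → S → S}
    {C : ℕ → S → Prop} (hC : ∀ n s t, C n s → T n s t → C (n + 1) t)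
    (hf : ∀ n, ∀ s ∈ M.controlled,
      u n s ≤ (open Classical in if T n s (f n s) then u (n + 1) (f n s) else 0) + δ n)
    {τ : M.Strategy} (hτ : ∀ (n : ℕ) (h : History S n), h.last ∈ M.controlled → C n h.last →
      τ.choose n h = PMF.pure (f n h.last))
    (k n : ℕ) (h : History S n) (hh : C n h.last) :
    u n h.last ≤ Kernel.traj (X := fun _ => S) τ.nextKernel n h (safeOn T n (n + k)) +
      ∑ i ∈ Finset.range k, δ (n + i) := by
  classical
  induction k generalizing n with
  | zero =>
    have : safeOn T n (n + 0) = Set.univ := Set.eq_univ_of_forall fun ρ m h1 h2 => by omega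
    simpa only [this, measure_univ] using le_add_right (hu_one n _)
  | succ k ih =>
    rw [safeOn_eq_inter T (by omega), traj_transition_inter τ n h (T n)
      (measurableSet_safeOn T _ _), Finset.sum_range_succ', add_zero, ← add_assoc]
    set D := ∑ i ∈ Finset.range k, δ (n + (i + 1)) with hD
    have hstep : ∀ t, (if T n h.last t then u (n + 1) t else 0) ≤
        (if T n h.last t then Kernel.traj (X := fun _ => S) τ.nextKernel (n + 1) (h.extend t)
          (safeOn T (n + 1) (n + (k + 1))) else 0) + D := by
      intro t
      split_ifs with hT
      · have := ih (n + 1) (h.extend t) (by simpa using hC n _ _ hh hT)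
        rw [h.last_extend] at this
        convert this using 2
        · congr 2; omega
        · exact Finset.sum_congr rfl fun i _ => by congr 1; omega
      · exact zero_le
    by_cases hs : h.last ∈ M.controlled
    · have hnext : τ.next n h = PMF.pure (f n h.last) := by
        rw [Strategy.next, dif_pos hs, hτ n h hs hh]
      rw [hnext, tsum_eq_single (f n h.last) fun t ht => by simp [PMF.pure_apply, ht]]
      simp only [PMF.pure_apply, if_true, one_mul]
      exact (hf n _ hs).trans (add_le_add_left (hstep _) _)
    · have hnext : τ.next n h = M.prob ⟨h.last, hs⟩ := by rw [Strategy.next, dif_neg hs]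
      rw [hnext]
      -- A random state loses nothing itself, so the error `δ n` is dropped.
      refine le_add_right ?_
      calc u n h.last ≤ _ := hu.random n ⟨h.last, hs⟩
        _ ≤ ∑' t, (M.prob ⟨h.last, hs⟩ t * _ + M.prob ⟨h.last, hs⟩ t * D) :=
          ENNReal.tsum_le_tsum fun t => (mul_le_mul_right (hstep t) _).trans_eq (mul_add _ _ _)
        _ = _ := by rw [ENNReal.tsum_add, ENNReal.tsum_mul_right, PMF.tsum_coe, one_mul]

/-! ### Approximation of the point payoff from inside -/

instance (M : MDP S) (s₀ : S) (σ : M.Strategy) : IsProbabilityMeasure (M.runMeasure s₀ σ) := by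
  unfold runMeasure
  infer_instance

lemma measurableSet_late (M : MDP S) (c : ℝ) (n : ℕ) : MeasurableSet (M.late c n) := by
  have h : ∀ m, MeasurableSet {ρ : ℕ → S | ∀ i, m ≤ i → c ≤ M.reward (ρ i) (ρ (i + 1))} :=
    fun m => measurableSet_safeFrom (fun _ s t => c ≤ M.reward s t) m
  have h' : MeasurableSet {ρ : ℕ → S | ∃ m, ∀ i, m ≤ i → c ≤ M.reward (ρ i) (ρ (i + 1))} := by
    rw [Set.ofPred_exists]
    exact .iUnion h
  exact h'.inter (h n).compl

lemma exists_measure_late_lt (M : MDP S) (μ : Measure (ℕ → S)) [IsFiniteMeasure μ] (c : ℝ)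
    {δ : ℝ≥0∞} (hδ : δ ≠ 0) : ∃ n, μ (M.late c n) < δ := by
  have hanti : Antitone (M.late c) := fun m n hmn ρ hρ =>
    ⟨hρ.1, fun h => hρ.2 fun i hi => h i (hmn.trans hi)⟩
  have hempty : ⋂ n, M.late c n = ∅ := by
    refine Set.eq_empty_of_forall_notMem fun ρ hρ => ?_
    obtain ⟨m, hm⟩ := (Set.mem_iInter.1 hρ 0).1
    exact (Set.mem_iInter.1 hρ m).2 hm
  have := tendsto_measure_iInter_atTop (μ := μ)
    (fun n => (M.measurableSet_late c n).nullMeasurableSet) hanti ⟨0, measure_ne_top _ _⟩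
  rw [hempty, measure_empty] at this
  exact (this.eventually (gt_mem_nhds hδ.bot_lt)).exists

/-- Up to a small loss of probability, a point payoff objective is a safety objective: by continuity
from above, a deterministic time `N k` can be fixed after which rewards below `-1 / (k + 1)` occur
on the winning runs with small probability only. -/
lemma exists_runMeasure_pointPayoff_le (M : MDP S) (s₀ : S) (σ : M.Strategy) {η : ℝ≥0∞}
    (hη : η ≠ 0) : ∃ N : ℕ → ℕ, M.runMeasure s₀ σ (M.pointPayoff s₀) ≤
      M.runMeasure s₀ σ (safeFrom (M.allowed N) 0) + η := by
  obtain ⟨δ, hδ, hsum⟩ := ENNReal.exists_pos_sum_of_countable' hη ℕ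
  choose N hN using fun k : ℕ =>
    M.exists_measure_late_lt (M.runMeasure s₀ σ) (-1 / ((k : ℝ) + 1)) (hδ k).ne'
  refine ⟨N, (measure_mono (M.pointPayoff_subset s₀ N)).trans ((measure_union_le _ _).trans ?_)⟩
  gcongr
  exact (measure_iUnion_le _).trans ((ENNReal.tsum_le_tsum fun k => (hN k).le).trans hsum.le)

lemma ae_runMeasure_zero (M : MDP S) (s₀ : S) (σ : M.Strategy) :
    ∀ᵐ ρ ∂M.runMeasure s₀ σ, ρ 0 = s₀ := by
  filter_upwards [ae_traj_frestrictLe σ 0 fun _ => s₀] with ρ hρ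
  exact congrFun hρ ⟨0, Finset.mem_Iic.2 le_rfl⟩

/-! ### Nearly optimal deterministic choices -/

/-- Time-dependent deterministic choices `f` that are `ε`-optimal. To serve both the strategies of
`M` that read the time off a clock and those of `M.stepEncode` that read it off the state, they need
to be followed only on histories whose last state satisfies `C` at the current time, for a condition
`C` that holds initially and is preserved by the transitions. -/
theorem exists_markov_choices (M : MDP S) (s₀ : S) (C : ℕ → S → Prop) (hC0 : C 0 s₀)
    (hC : ∀ n s t, C n s → M.step s t → C (n + 1) t) {ε : ℝ} (hε : 0 < ε) :
    ∃ f : ℕ → S → S, (∀ n s, M.step s (f n s)) ∧ ∀ τ : M.Strategy,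
      (∀ (n : ℕ) (h : History S n), h.last ∈ M.controlled → C n h.last →
        τ.choose n h = PMF.pure (f n h.last)) →
      τ.IsEpsOptimal (M.pointPayoff s₀) s₀ ε := by
  -- One third of `ε` each for the choice of `σ`, the passage to safety, and the greedy choices.
  set η := ENNReal.ofReal ε / 3 with hη_def
  have hη : η ≠ 0 := by simp [hη_def, hε]
  obtain ⟨σ, hσ⟩ : ∃ σ : M.Strategy,
      M.value (M.pointPayoff s₀) s₀ ≤ M.runMeasure s₀ σ (M.pointPayoff s₀) + η := by
    by_cases h0 : M.value (M.pointPayoff s₀) s₀ = 0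
    · exact ⟨Classical.arbitrary _, by simp [h0]⟩
    · have htop : M.value (M.pointPayoff s₀) s₀ ≠ ∞ :=
        ((iSup_le fun _ => prob_le_one).trans_lt ENNReal.one_lt_top).ne
      obtain ⟨σ, hσ⟩ := lt_iSup_iff.1 (ENNReal.sub_lt_self htop h0 hη)
      exact ⟨σ, tsub_le_iff_right.1 hσ.le⟩
  obtain ⟨N, hN⟩ := M.exists_runMeasure_pointPayoff_le s₀ σ hη
  set T := M.allowed N with hT_def
  obtain ⟨δ, hδ, hsum⟩ := ENNReal.exists_pos_sum_of_countable' hη ℕ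
  have hu := σ.isSubharmonic_safety T
  obtain ⟨f, hstep, hf⟩ := hu.exists_greedy (σ.safety_le_one T) (fun n s t h => h.1)
    fun n => (hδ n).ne'
  refine ⟨f, hstep, fun τ hτ => ?_⟩
  have hfin : ∀ k, σ.safety T 0 s₀ ≤ M.runMeasure s₀ τ (safeOn T 0 k) + η := fun k => by
    have := hu.le_traj_safeOn (σ.safety_le_one T) (fun n s t h ht => hC n s t h ht.1) hf hτ k 0
      (fun _ => s₀) hC0
    simp only [zero_add] at this
    exact this.trans (add_le_add_right ((ENNReal.sum_le_tsum _).trans hsum.le) _)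
  have hlim : Tendsto (fun k => M.runMeasure s₀ τ (safeOn T 0 k)) atTop
      (nhds (M.runMeasure s₀ τ (safeFrom T 0))) := by
    have hInter : safeFrom T 0 = ⋂ k, safeOn T 0 k := by
      ext ρ
      simp only [Set.mem_iInter]
      exact ⟨fun h k n hn _ => h n hn, fun h n hn => h (n + 1) n hn n.lt_succ_self⟩
    rw [hInter]
    exact tendsto_measure_iInter_atTop
      (fun k => (measurableSet_safeOn T 0 k).nullMeasurableSet)
      (fun k l hkl ρ hρ n hn hk => hρ n hn (hk.trans_le hkl)) ⟨0, measure_ne_top _ _⟩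
  have hsafe : σ.safety T 0 s₀ ≤ M.runMeasure s₀ τ (safeFrom T 0) + η :=
    ge_of_tendsto' (hlim.add_const η) hfin
  have hwin : M.runMeasure s₀ τ (safeFrom T 0) ≤ M.runMeasure s₀ τ (M.pointPayoff s₀) :=
    measure_mono_ae <| by
      filter_upwards [M.ae_runMeasure_zero s₀ τ] with ρ h0 hρ
      exact mem_pointPayoff_of_mem_safeFrom h0 hρ
  calc M.value (M.pointPayoff s₀) s₀
      ≤ M.runMeasure s₀ σ (safeFrom T 0) + η + η := hσ.trans (add_le_add_left hN η)
    _ ≤ σ.safety T 0 s₀ + η + η := by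
        gcongr
        exact σ.le_safety T 0 fun _ => s₀
    _ ≤ M.runMeasure s₀ τ (M.pointPayoff s₀) + η + η + η := by
        gcongr
        exact hsafe.trans (add_le_add_left hwin η)
    _ = M.runMeasure s₀ τ (M.pointPayoff s₀) + ENNReal.ofReal ε := by
        rw [add_assoc, add_assoc, ← add_assoc η, ENNReal.add_thirds]

end MDP

theorem mainTheorem2 {S : Type*} [Countable S] [MeasurableSpace S] [DiscreteMeasurableSpace S]
    (M : MDP S) (s₀ : S) (ε : ℝ) (hε : 0 < ε) :
    (∃ σ : M.stepEncode.Strategy, σ.IsDeterministic ∧ σ.IsMemoryless ∧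
      σ.IsEpsOptimal (M.stepEncode.pointPayoff (s₀, 0)) (s₀, 0) ε) ∧
    (∃ σ : M.Strategy, σ.IsDeterministic ∧ σ.IsMarkov ∧
      σ.IsEpsOptimal (M.pointPayoff s₀) s₀ ε) := by
  constructor
  · obtain ⟨f, hstep, hf⟩ := M.stepEncode.exists_markov_choices (s₀, 0) (fun n p => p.2 = n) rfl
      (fun n p q hp hpq => hpq.2.trans (by rw [hp])) hε
    refine ⟨.ofFun (fun _ h => f h.last.2 h.last) fun _ h => hstep _ _,
      MDP.Strategy.ofFun_isDeterministic _ _, ⟨fun p => PMF.pure (f p.2 p), fun _ _ _ => rfl⟩,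
      hf _ fun n h _ hn => ?_⟩
    change PMF.pure (f h.last.2 h.last) = _
    rw [hn]
  · obtain ⟨f, hstep, hf⟩ := M.exists_markov_choices s₀ (fun _ _ => True) trivial
      (fun _ _ _ _ _ => trivial) hε
    exact ⟨.ofFun (fun n h => f n h.last) fun _ h => hstep _ _,
      MDP.Strategy.ofFun_isDeterministic _ _, ⟨fun n s => PMF.pure (f n s), fun _ _ _ => rfl⟩,
      hf _ fun _ _ _ _ => rfl⟩
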